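/- Let $m\ge 1$ be an integer and let $S=\mathbb{Q}[t^{\pm1}]/(t^2-3t+1)^m$. Let $\Gamma_0$ be the infinite cyclic group generated by $\mu$, and let $\Gamma_1=S\rtimes\Gamma_0$ be the semidirect product in which $\mu$ acts on the additive group $S$ from the right by multiplication by $t$, i.e. $\mu^{-1}s\mu=ts$ for $s\in S$. Let \[ \mathcal{R}_1=(\mathbb{Q}\Gamma_1)\,(\mathbb{Q}[\Gamma_1,\Gamma_1]-\{0\})^{-1} \] be the Ore localization of the rational group ring of $\Gamma_1$ at the nonzero elements of the group ring $\mathbb{Q}[\Gamma_1,\Gamma_1]$ of its commutator subgroup. Then every finitely generated right torsion $\mathcal{R}_1$-module $M$ is cyclic: if $M$ is a finitely generated right $\mathcal{R}_1$-module such that for every $x\in M$ there is a nonzero $r\in\mathcal{R}_1$ with $xr=0$, then $M=x\mathcal{R}_1$ for some $x\in M$. -/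

import Mathlib

open scoped LaurentPolynomial MonoidAlgebra MulOpposite

noncomputable section

namespace HigherOrder

/-- `S_m = ℚ[t^{±1}] / (t² - 3t + 1)^m`, where `t = LaurentPolynomial.T 1`. -/
abbrev S (m : ℕ) : Type :=
  ℚ[T;T⁻¹] ⧸ Ideal.span
    {((LaurentPolynomial.T 2 - 3 * LaurentPolynomial.T 1 + 1 : ℚ[T;T⁻¹]) ^ m)}

/-- The class of `t ^ k` in `S m`. -/
def tpow (m : ℕ) (k : ℤ) : S m := Ideal.Quotient.mk _ (LaurentPolynomial.T k)

lemma tpow_zero (m : ℕ) : tpow m 0 = 1 := by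
  simp [tpow]

lemma tpow_add (m : ℕ) (j k : ℤ) : tpow m (j + k) = tpow m j * tpow m k := by
  rw [tpow, LaurentPolynomial.T_add, map_mul, tpow, tpow]

/-- Multiplication by `t ^ k`, as an automorphism of the additive group `S m`
(written multiplicatively). -/
def tMul (m : ℕ) (k : ℤ) : MulAut (Multiplicative (S m)) where
  toFun s := Multiplicative.ofAdd (tpow m k * s.toAdd)
  invFun s := Multiplicative.ofAdd (tpow m (-k) * s.toAdd)
  left_inv s := by
    simp [← mul_assoc, ← tpow_add, tpow_zero]
  right_inv s := by
    simp [← mul_assoc, ← tpow_add, tpow_zero]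
  map_mul' s s' := by
    simp [mul_add]

/-- The action of the infinite cyclic group `Γ₀ = ⟨μ⟩` (with `μ = Multiplicative.ofAdd 1`) on `S m`
in which `μ ^ k` acts on the left as multiplication by `t ^ (-k)`, so that `μ` acts on the right,
by `s ↦ μ⁻¹ s μ`, as multiplication by `t`. -/
def action (m : ℕ) : Multiplicative ℤ →* MulAut (Multiplicative (S m)) where
  toFun k := tMul m (-k.toAdd)
  map_one' := by
    ext s
    simp [tMul, tpow_zero]
  map_mul' j k := by
    ext s
    simp only [tMul, toAdd_mul, neg_add, MulEquiv.coe_mk, Equiv.coe_fn_mk, MulAut.mul_apply,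
      toAdd_ofAdd, tpow_add, mul_assoc]

/-- The group `Γ₁ = S_m ⋊ Γ₀`. -/
abbrev Gamma (m : ℕ) : Type := Multiplicative (S m) ⋊[action m] Multiplicative ℤ

/-- The meridional generator `μ` of `Γ₀`, as an element of `Γ₁`. -/
def mu (m : ℕ) : Gamma m := SemidirectProduct.inr (Multiplicative.ofAdd 1)

/-- In `Γ₁` one has `μ⁻¹ s μ = t s`: the right action of `μ` on `S_m` is multiplication by `t`. -/
lemma mu_inv_mul_mul_mu (m : ℕ) (s : S m) :
    (mu m)⁻¹ * SemidirectProduct.inl (Multiplicative.ofAdd s) * mu m =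
      SemidirectProduct.inl (Multiplicative.ofAdd (tpow m 1 * s)) := by
  have h : action m (Multiplicative.ofAdd 1)⁻¹ (Multiplicative.ofAdd s) =
      Multiplicative.ofAdd (tpow m 1 * s) := by
    simp [action, tMul]
  rw [← h, SemidirectProduct.inl_aut, mu, map_inv, inv_inv]

/-- A semidirect product of two groups with unique products has unique products. -/
lemma uniqueProds_semidirect {N G : Type*} [Group N] [Group G] (φ : G →* MulAut N)
    [UniqueProds N] [UniqueProds G] : UniqueProds (N ⋊[φ] G) where
  uniqueMul_of_nonempty {A B} hA hB := by
    classical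
    let f : (N ⋊[φ] G) →ₙ* G := (SemidirectProduct.rightHom : (N ⋊[φ] G) →* G).toMulHom
    have hf : ∀ x, f x = x.right := fun _ => rfl
    obtain ⟨p, hp, q, hq, hu⟩ := UniqueProds.uniqueMul_of_nonempty (hA.image f) (hB.image f)
    obtain ⟨a₁, ha₁, hp'⟩ := Finset.mem_image.1 hp
    obtain ⟨b₁, hb₁, hq'⟩ := Finset.mem_image.1 hq
    have hA' : ({a ∈ A | f a = p}.image (fun a => a.left)).Nonempty :=
      ⟨a₁.left, Finset.mem_image_of_mem _ (Finset.mem_filter.2 ⟨ha₁, hp'⟩)⟩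
    have hB' : ({b ∈ B | f b = q}.image (fun b => φ p b.left)).Nonempty :=
      ⟨φ p b₁.left, Finset.mem_image_of_mem (fun b : N ⋊[φ] G => φ p b.left)
        (Finset.mem_filter.2 ⟨hb₁, hq'⟩)⟩
    obtain ⟨x, hx, y, hy, hv⟩ := UniqueProds.uniqueMul_of_nonempty hA' hB'
    obtain ⟨a, ha, rfl⟩ := Finset.mem_image.1 hx
    obtain ⟨b, hb, rfl⟩ := Finset.mem_image.1 hy
    have haf := (Finset.mem_filter.1 ha).2
    have hbf := (Finset.mem_filter.1 hb).2
    refine ⟨a, (Finset.mem_filter.1 ha).1, b, (Finset.mem_filter.1 hb).1,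
      UniqueMul.of_image_filter f haf hbf hu ?_⟩
    intro c d hc hd hcd
    have hcf := (Finset.mem_filter.1 hc).2
    have hdf := (Finset.mem_filter.1 hd).2
    have hl := congrArg SemidirectProduct.left hcd
    rw [SemidirectProduct.mul_left, SemidirectProduct.mul_left, ← hf c, ← hf a, hcf, haf] at hl
    obtain ⟨h1, h2⟩ := hv (Finset.mem_image_of_mem _ hc)
      (Finset.mem_image_of_mem (fun b : N ⋊[φ] G => φ p b.left) hd) hl
    refine ⟨SemidirectProduct.ext h1 ?_, SemidirectProduct.ext ((φ p).injective h2) ?_⟩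
    · rw [← hf, ← hf, hcf, haf]
    · rw [← hf, ← hf, hdf, hbf]

instance (m : ℕ) : UniqueProds (Gamma m) := uniqueProds_semidirect (action m)

/-- The subring `ℚ[Γ₁, Γ₁]` of the group ring `ℚΓ₁`, i.e. the group ring of the commutator
subgroup of `Γ₁`. -/
def commRing (m : ℕ) : Subring ℚ[Gamma m] :=
  (MonoidAlgebra.mapDomainRingHom ℚ (commutator (Gamma m)).subtype).range

/-- The multiplicative set `ℚ[Γ₁, Γ₁] - {0}` in `ℚΓ₁`. -/
def denoms (m : ℕ) : Submonoid ℚ[Gamma m] where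
  carrier := {x | x ∈ commRing m ∧ x ≠ 0}
  one_mem' := ⟨one_mem _, one_ne_zero⟩
  mul_mem' hx hy := ⟨mul_mem hx.1 hy.1, mul_ne_zero hx.2 hy.2⟩

lemma commutator_commute (m : ℕ) {x y : Gamma m} (hx : x ∈ commutator (Gamma m))
    (hy : y ∈ commutator (Gamma m)) : x * y = y * x := by
  have key : ∀ z ∈ commutator (Gamma m), z.right = 1 := fun z hz =>
    Abelianization.commutator_subset_ker
      (SemidirectProduct.rightHom : Gamma m →* Multiplicative ℤ) hz
  ext
  · simp [key x hx, key y hy, add_comm]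
  · simp [key x hx, key y hy]

lemma commRing_commute (m : ℕ) {x y : ℚ[Gamma m]} (hx : x ∈ commRing m) (hy : y ∈ commRing m) :
    x * y = y * x := by
  let _ : CommGroup (commutator (Gamma m)) :=
    { (inferInstance : Group (commutator (Gamma m))) with
      mul_comm := fun a b => Subtype.ext (commutator_commute m a.2 b.2) }
  obtain ⟨x, rfl⟩ := hx
  obtain ⟨y, rfl⟩ := hy
  rw [← map_mul, ← map_mul, mul_comm x y]

lemma conj_mem_commRing (m : ℕ) (g : Gamma m) {x : ℚ[Gamma m]} (hx : x ∈ commRing m) :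
    MonoidAlgebra.single g 1 * x * MonoidAlgebra.single g⁻¹ 1 ∈ commRing m := by
  obtain ⟨x, rfl⟩ := hx
  induction x using MonoidAlgebra.induction_linear with
  | zero => simp
  | add x y hx hy =>
    rw [map_add, mul_add, add_mul]
    exact add_mem hx hy
  | single c r =>
    refine ⟨MonoidAlgebra.single
      ⟨g * c * g⁻¹, (inferInstance : (commutator (Gamma m)).Normal).conj_mem c c.2 g⟩ r, ?_⟩
    simp [MonoidAlgebra.single_mul_single]

lemma single_mul_single_inv (m : ℕ) (g : Gamma m) :
    (MonoidAlgebra.single g 1 * MonoidAlgebra.single g⁻¹ 1 : ℚ[Gamma m]) = 1 := by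
  simp [MonoidAlgebra.single_mul_single, MonoidAlgebra.one_def]

lemma single_inv_mul_single (m : ℕ) (g : Gamma m) :
    (MonoidAlgebra.single g⁻¹ 1 * MonoidAlgebra.single g 1 : ℚ[Gamma m]) = 1 := by
  simp [MonoidAlgebra.single_mul_single, MonoidAlgebra.one_def]

lemma conj_mem_denoms (m : ℕ) (g : Gamma m) {x : ℚ[Gamma m]} (hx : x ∈ denoms m) :
    MonoidAlgebra.single g 1 * x * MonoidAlgebra.single g⁻¹ 1 ∈ denoms m := by
  refine ⟨conj_mem_commRing m g hx.1, mul_ne_zero (mul_ne_zero ?_ hx.2) ?_⟩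
  · exact left_ne_zero_of_mul_eq_one (single_mul_single_inv m g)
  · exact right_ne_zero_of_mul_eq_one (single_mul_single_inv m g)

/-- The left Ore condition. -/
lemma left_ore (m : ℕ) (r : ℚ[Gamma m]) (s : denoms m) :
    ∃ (r' : ℚ[Gamma m]) (s' : denoms m), (s' : ℚ[Gamma m]) * r = r' * s := by
  induction r using MonoidAlgebra.induction_linear with
  | zero => exact ⟨0, 1, by simp⟩
  | add x y hx hy =>
    obtain ⟨x', s₁, h₁⟩ := hx
    obtain ⟨y', s₂, h₂⟩ := hy
    refine ⟨s₂ * x' + s₁ * y', s₁ * s₂, ?_⟩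
    have hc := commRing_commute m s₁.2.1 s₂.2.1
    rw [Submonoid.coe_mul, mul_add, add_mul, mul_assoc _ x', mul_assoc _ y', ← h₁, ← h₂,
      ← mul_assoc, ← mul_assoc, hc]
  | single g c =>
    refine ⟨MonoidAlgebra.single g c, ⟨_, conj_mem_denoms m g s.2⟩, ?_⟩
    have h : (MonoidAlgebra.single g c : ℚ[Gamma m]) =
        c • MonoidAlgebra.single g 1 := by simp
    rw [h]
    simp only [mul_smul_comm, smul_mul_assoc]
    rw [mul_assoc, single_inv_mul_single, mul_one]

/-- The right Ore condition. -/
lemma right_ore (m : ℕ) (r : ℚ[Gamma m]) (s : denoms m) :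
    ∃ (r' : ℚ[Gamma m]) (s' : denoms m), r * (s' : ℚ[Gamma m]) = s * r' := by
  induction r using MonoidAlgebra.induction_linear with
  | zero => exact ⟨0, 1, by simp⟩
  | add x y hx hy =>
    obtain ⟨x', s₁, h₁⟩ := hx
    obtain ⟨y', s₂, h₂⟩ := hy
    refine ⟨x' * s₂ + y' * s₁, s₁ * s₂, ?_⟩
    have hc := commRing_commute m s₁.2.1 s₂.2.1
    rw [Submonoid.coe_mul, mul_add, add_mul, ← mul_assoc, h₁, hc, ← mul_assoc, h₂,
      mul_assoc, mul_assoc]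
  | single g c =>
    have hg := conj_mem_denoms m g⁻¹ s.2
    rw [inv_inv] at hg
    refine ⟨MonoidAlgebra.single g c, ⟨_, hg⟩, ?_⟩
    have h : (MonoidAlgebra.single g c : ℚ[Gamma m]) =
        c • MonoidAlgebra.single g 1 := by simp
    rw [h]
    simp only [mul_smul_comm, smul_mul_assoc]
    rw [← mul_assoc, ← mul_assoc, single_mul_single_inv, one_mul]

instance (m : ℕ) : OreLocalization.OreSet (denoms m) :=
  (OreLocalization.nonempty_oreSet_iff_of_noZeroDivisors.2 (left_ore m)).some

/-- The ring `𝓡₁ = (ℚΓ₁)(ℚ[Γ₁, Γ₁] - {0})⁻¹`. Both Ore conditions hold, so the rings of left and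
of right fractions coincide; the lemmas below record that this is the ring of right fractions. -/
abbrev R1 (m : ℕ) : Type := OreLocalization (denoms m) ℚ[Gamma m]

/-- The canonical homomorphism `ℚΓ₁ → 𝓡₁`. -/
def toR1 (m : ℕ) : ℚ[Gamma m] →+* R1 m := OreLocalization.numeratorRingHom

lemma toR1_injective (m : ℕ) : Function.Injective (toR1 m) :=
  OreLocalization.numeratorHom_inj fun _ hs =>
    (mem_nonZeroDivisors_of_ne_zero hs.2).1

lemma isUnit_toR1 (m : ℕ) (s : denoms m) : IsUnit (toR1 m s) :=
  OreLocalization.numerator_isUnit s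

/-- Every element of `𝓡₁` is a right fraction `a s⁻¹`. -/
lemma exists_right_fraction (m : ℕ) (x : R1 m) :
    ∃ (a : ℚ[Gamma m]) (s : denoms m), x * toR1 m s = toR1 m a := by
  induction x using OreLocalization.ind with
  | _ r s =>
    obtain ⟨a, s', h⟩ := right_ore m r s
    refine ⟨a, s', ?_⟩
    obtain ⟨u, hu⟩ := isUnit_toR1 m s
    have h1 : (r /ₒ s : R1 m) = ↑u⁻¹ * toR1 m r := by
      rw [Units.eq_inv_mul_iff_mul_eq, hu]
      exact OreLocalization.smul_cancel
    rw [h1, mul_assoc, ← map_mul, h, map_mul, ← hu, Units.inv_mul_cancel_left]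

/-- A right module `M` over a domain `R` is a torsion module if every element of `M` is annihilated
by some nonzero element of `R`. -/
def IsRightTorsion (R M : Type*) [Ring R] [AddCommGroup M] [Module Rᵐᵒᵖ M] : Prop :=
  ∀ x : M, ∃ r : R, r ≠ 0 ∧ MulOpposite.op r • x = 0

/-- A right `R`-module `M` is cyclic if `M = x R` for some `x` in `M`. -/
def IsRightCyclic (R M : Type*) [Ring R] [AddCommGroup M] [Module Rᵐᵒᵖ M] : Prop :=
  ∃ x : M, ∀ y : M, ∃ r : R, y = MulOpposite.op r • x

end HigherOrder

end

open MulOpposite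
open scoped LaurentPolynomial MonoidAlgebra

noncomputable section

namespace HigherOrder

/-! Let `K` be the field of fractions of the commutative domain `ℚ[Γ₁, Γ₁]`. Conjugation by `μ`
preserves `K`, and `𝓡₁` is a skew Laurent ring `K[μ^{±1}]` (`isOuterSkewLaurent_R1`). Since `t` has
infinite order in `S`, no nonzero power of `μ` centralizes `K`, so `𝓡₁` is simple
(`IsOuterSkewLaurent.isSimpleRing`).

A nonzero annihilator of `x` is a linear recurrence among the `x μ ^ i`, solvable at both ends.
Hence a finitely generated torsion module is finite-dimensional over `K`
(`IsOuterSkewLaurent.module_finite`) and has finite length.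

Over a simple ring, a generator is then built along a composition series. Suppose `x` generates `M`
modulo `P'` and `P' / P` is simple. The annihilator of `P' / P` is a proper two-sided ideal, hence
zero, while `x` has a nonzero annihilator. So some `r` kills `x` modulo `P` but not some `y ∈ P'`,
and `x + y` generates `M` modulo `P`. -/

/-! ### Torsion modules of finite length over a simple ring -/

/-- Over a simple ring, a torsion right module which is both artinian and noetherian is cyclic. -/
theorem isRightCyclic_of_isSimpleRing {R M : Type*} [Ring R] [IsSimpleRing R] [AddCommGroup M]
    [Module Rᵐᵒᵖ M] [IsArtinian Rᵐᵒᵖ M] [IsNoetherian Rᵐᵒᵖ M] (hM : IsRightTorsion R M) :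
    IsRightCyclic R M := by
  suffices h : ∀ P : Submodule Rᵐᵒᵖ M, ∃ x : M, P ⊔ Submodule.span Rᵐᵒᵖ {x} = ⊤ by
    obtain ⟨x, hx⟩ := h ⊥
    refine ⟨x, fun y => ?_⟩
    have hy : y ∈ Submodule.span Rᵐᵒᵖ {x} := by
      rw [← bot_sup_eq (Submodule.span Rᵐᵒᵖ {x}), hx]
      trivial
    obtain ⟨r, hr⟩ := Submodule.mem_span_singleton.1 hy
    exact ⟨r.unop, by simpa using hr.symm⟩
  intro P
  induction P using WellFoundedGT.induction with
  | _ P ih =>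
  rcases eq_or_ne P ⊤ with rfl | hP
  · exact ⟨0, by simp⟩
  -- Noetherian induction runs from `⊤` down to `⊥`; the artinian hypothesis supplies a submodule
  -- covering `P`.
  obtain ⟨P', hcov, -⟩ := exists_covBy_le_of_lt (lt_top_iff_ne_top.2 hP)
  obtain ⟨x, hx⟩ := ih P' hcov.lt
  obtain ⟨y, hy, r, hxr, hyr⟩ : ∃ y ∈ P', ∃ r : R, op r • x ∈ P ∧ op r • y ∉ P := by
    -- Otherwise everything killing `x` modulo `P` lies in the annihilator `J` of `P' / P`. As `x`
    -- is torsion, `J` is nonzero, hence everything, which forces `P' ≤ P`.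
    by_contra! hcon
    let J : TwoSidedIdeal R := TwoSidedIdeal.mk' {r | ∀ y ∈ P', op r • y ∈ P}
      (by simp)
      (fun {r s} hr hs y hy => by
        rw [MulOpposite.op_add, add_smul]; exact add_mem (hr y hy) (hs y hy))
      (fun {r} hr y hy => by
        rw [MulOpposite.op_neg, neg_smul]; exact neg_mem (hr y hy))
      (fun {r s} hs y hy => by
        rw [MulOpposite.op_mul, mul_smul]; exact hs _ (P'.smul_mem _ hy))
      (fun {r s} hr y hy => by
        rw [MulOpposite.op_mul, mul_smul]; exact P.smul_mem _ (hr y hy))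
    obtain ⟨r, hr0, hr⟩ := hM x
    have hrJ : r ∈ J := (TwoSidedIdeal.mem_mk' _ _ _ _ _ _ _).2 fun y hy =>
      hcon y hy r (by rw [hr]; exact zero_mem _)
    have hJ : J = ⊤ := (IsSimpleRing.simple.eq_bot_or_eq_top J).resolve_left fun h => hr0 (by
      rw [h] at hrJ; exact (TwoSidedIdeal.mem_bot R).1 hrJ)
    have h1 : (1 : R) ∈ J := (TwoSidedIdeal.one_mem_iff J).2 hJ
    refine hcov.lt.not_ge fun z hz => ?_
    simpa using (TwoSidedIdeal.mem_mk' _ _ _ _ _ _ _).1 h1 z hz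
  refine ⟨x + y, ?_⟩
  set Q := P ⊔ Submodule.span Rᵐᵒᵖ {x + y} with hQ
  have hPQ : P ≤ Q := le_sup_left
  have hxy : x + y ∈ Q := Submodule.mem_sup_right (Submodule.mem_span_singleton_self _)
  have hyQ : op r • y ∈ Q := by
    have h := sub_mem (Q.smul_mem (op r) hxy) (hPQ hxr)
    rwa [smul_add, add_sub_cancel_left] at h
  have hP'Q : P' ≤ Q := by
    have h : P ⊔ Submodule.span Rᵐᵒᵖ {op r • y} = P' := by
      refine (hcov.eq_or_eq le_sup_left (sup_le hcov.le ?_)).resolve_left fun h => hyr ?_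
      · rw [Submodule.span_singleton_le_iff_mem]
        exact P'.smul_mem _ hy
      · rw [← h]
        exact Submodule.mem_sup_right (Submodule.mem_span_singleton_self _)
    rw [← h]
    exact sup_le hPQ ((Submodule.span_singleton_le_iff_mem _ _).2 hyQ)
  rw [eq_top_iff, ← hx]
  refine sup_le hP'Q ((Submodule.span_singleton_le_iff_mem _ _).2 ?_)
  have h := sub_mem hxy (hP'Q hy)
  rwa [add_sub_cancel_right] at h

/-! ### Simplicity of outer skew Laurent rings -/

/-- The properties of a skew Laurent polynomial ring `R = K[u^{±1}; σ]` over a field `K` in which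
no nontrivial power of `u` commutes with `K`. -/
structure IsOuterSkewLaurent {K R : Type*} [Field K] [Ring R] (f : K →+* R) (u : Rˣ) : Prop where
  exists_mul_zpow : ∀ (i : ℤ) (k : K), ∃ k' : K, f k * ↑(u ^ i) = ↑(u ^ i) * f k'
  exists_sum : ∀ r : R, ∃ p : ℤ →₀ K, r = p.sum fun i k => ↑(u ^ i) * f k
  exists_not_commute : ∀ i : ℤ, i ≠ 0 → ∃ c : K, f c * ↑(u ^ i) ≠ ↑(u ^ i) * f c

namespace IsOuterSkewLaurent

variable {K R : Type*} [Field K] [Ring R] {f : K →+* R} {u : Rˣ}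

lemma exists_zpow_mul (h : IsOuterSkewLaurent f u) (i : ℤ) (k : K) :
    ∃ k' : K, f k' * ↑(u ^ i) = ↑(u ^ i) * f k := by
  obtain ⟨k', hk'⟩ := h.exists_mul_zpow (-i) k
  refine ⟨k', ?_⟩
  rw [zpow_neg, Units.eq_inv_mul_iff_mul_eq, ← mul_assoc, Units.mul_inv_eq_iff_eq_mul] at hk'
  exact hk'.symm

/-- Take an expression of minimal support with value in `J`. Subtracting two twisted multiples of it
cancels one term, so by minimality all its exponents twist `K` alike. Outerness leaves a single
exponent, and a nonzero monomial is a unit. -/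
lemma isSimpleRing [Nontrivial R] (h : IsOuterSkewLaurent f u) : IsSimpleRing R := by
  classical
  refine ⟨⟨fun J => or_iff_not_imp_left.2 fun hJ => ?_⟩⟩
  -- Supports are formal: uniqueness of expansions is not assumed, so the sum may vanish in `R`.
  -- This is harmless, since the minimal support turns out to be a singleton.
  let A : Set (Finset ℤ) := {s | s.Nonempty ∧ ∃ k : ℤ → K, (∀ i ∈ s, k i ≠ 0) ∧
    ∑ i ∈ s, ↑(u ^ i) * f (k i) ∈ J}
  have hA : A.Nonempty := by
    obtain ⟨r, hrJ, hr⟩ : ∃ r ∈ J, r ≠ 0 := by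
      by_contra! hcon
      exact hJ (le_bot_iff.1 fun r hr => (TwoSidedIdeal.mem_bot R).2 (hcon r hr))
    obtain ⟨p, rfl⟩ := h.exists_sum r
    refine ⟨p.support, ?_, p, fun i hi => Finsupp.mem_support_iff.1 hi, hrJ⟩
    rw [Finsupp.support_nonempty_iff]
    rintro rfl
    simp at hr
  obtain ⟨s, ⟨⟨i₀, hi₀⟩, k, hk, hJs⟩, hmin⟩ :=
    (InvImage.wf (Finset.card : Finset ℤ → ℕ) wellFounded_lt).has_min A hA
  have key : ∀ i ∈ s, ∀ c c' : K, f c' * ↑(u ^ i₀) = ↑(u ^ i₀) * f c →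
      f c' * ↑(u ^ i) = ↑(u ^ i) * f c := by
    intro i hi c c' hc
    choose τ hτ using fun j => h.exists_mul_zpow j c'
    have hτ₀ : τ i₀ = c := by
      have := hc.symm.trans (hτ i₀)
      rw [Units.mul_right_inj] at this
      exact (f.injective this).symm
    by_contra hne
    have hτi : τ i ≠ c := fun e => hne (by rw [hτ i, e])
    let q : ℤ → K := fun j => (τ j - c) * k j
    refine hmin {j ∈ s | q j ≠ 0} ⟨⟨i, ?_⟩, q, fun j hj => (Finset.mem_filter.1 hj).2, ?_⟩ ?_
    · exact Finset.mem_filter.2 ⟨hi, mul_ne_zero (sub_ne_zero.2 hτi) (hk i hi)⟩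
    · rw [Finset.sum_filter_of_ne fun j _ hj => by rintro e; simp [e] at hj]
      have : ∑ j ∈ s, ↑(u ^ j) * f (q j) =
          f c' * ∑ j ∈ s, ↑(u ^ j) * f (k j) - (∑ j ∈ s, ↑(u ^ j) * f (k j)) * f c := by
        rw [Finset.mul_sum, Finset.sum_mul, ← Finset.sum_sub_distrib]
        refine Finset.sum_congr rfl fun j _ => ?_
        rw [← mul_assoc, hτ j, mul_assoc, mul_assoc, ← map_mul, ← map_mul, ← mul_sub, ← map_sub,
          mul_comm (k j) c, ← sub_mul]
      rw [this]
      exact sub_mem (J.mul_mem_left _ _ hJs) (J.mul_mem_right _ _ hJs)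
    · refine Finset.card_lt_card (Finset.filter_ssubset.2 ⟨i₀, hi₀, ?_⟩)
      simp [q, hτ₀]
  have hs : s = {i₀} := by
    refine Finset.eq_singleton_iff_unique_mem.2 ⟨hi₀, fun i hi => ?_⟩
    by_contra hne
    -- If `u ^ i` and `u ^ i₀` both carry `c` to the same `c'`, then `c` commutes with `u ^ (i -
    -- i₀)`.
    obtain ⟨c, hc⟩ := h.exists_not_commute (i - i₀) (sub_ne_zero.2 hne)
    obtain ⟨c', hc'⟩ := h.exists_zpow_mul i₀ c
    refine hc ?_
    have h1 := key i hi c c' hc'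
    rw [← Units.eq_mul_inv_iff_mul_eq] at hc'
    rw [hc', mul_assoc, mul_assoc] at h1
    rw [← Units.mul_right_inj (u ^ i₀)]
    rw [← mul_assoc (↑(u ^ i₀) : R) ↑(u ^ (i - i₀)), ← Units.val_mul, ← zpow_add,
      add_sub_cancel, ← h1, sub_eq_neg_add, zpow_add, zpow_neg, Units.val_mul]
  rw [← TwoSidedIdeal.one_mem_iff]
  rw [hs, Finset.sum_singleton] at hJs
  have := J.mul_mem_left (f (k i₀)⁻¹ * ↑(u ^ i₀)⁻¹) _ hJs
  rwa [mul_assoc, Units.inv_mul_cancel_left, ← map_mul, inv_mul_cancel₀ (hk i₀ hi₀), map_one]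
    at this

/-! ### Finite-dimensionality of torsion modules -/

variable {M : Type*} [AddCommGroup M] [Module Rᵐᵒᵖ M]

/-- A cyclic torsion right module is finite-dimensional over the coefficient field. -/
lemma exists_fg_submodule [Nontrivial R] [Module K M] (h : IsOuterSkewLaurent f u)
    (hf : ∀ (k : K) (x : M), k • x = op (f k) • x) {x : M} {r : R} (hr : r ≠ 0)
    (hx : op r • x = 0) : ∃ W : Submodule K M, W.FG ∧ ∀ s : R, op s • x ∈ W := by
  classical
  obtain ⟨p, rfl⟩ := h.exists_sum r
  have hp : p.support.Nonempty := by
    rw [Finsupp.support_nonempty_iff]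
    rintro rfl
    simp at hr
  set v : ℤ → M := fun i => op (↑(u ^ i) : R) • x with hv
  set a := p.support.min' hp
  set b := p.support.max' hp
  set W : Submodule K M := Submodule.span K ((Finset.Ico a b).image v : Finset M) with hW
  -- Multiplying the relation `x r = 0` by `u ^ j` shifts the recurrence; every coefficient stays
  -- nonzero and can be divided by.
  have hsolve : ∀ i₀ ∈ p.support, ∀ j : ℤ, (∀ i ∈ p.support, i ≠ i₀ → v (i + j) ∈ W) →
      v (i₀ + j) ∈ W := by
    intro i₀ hi₀ j hj
    choose τ hτ using h.exists_mul_zpow j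
    have hrel : ∑ i ∈ p.support, τ (p i) • v (i + j) = 0 := by
      have h0 : op (↑(u ^ j) : R) • op (p.sum fun i k => ↑(u ^ i) * f k) • x = 0 := by
        rw [hx, smul_zero]
      rw [← mul_smul, ← MulOpposite.op_mul, Finsupp.sum, Finset.sum_mul, Finset.op_sum,
        Finset.sum_smul] at h0
      rw [← h0]
      refine Finset.sum_congr rfl fun i _ => ?_
      rw [hf, hv]
      dsimp only
      rw [← mul_smul, ← MulOpposite.op_mul, mul_assoc, hτ, zpow_add, Units.val_mul, mul_assoc]
    rw [← Finset.add_sum_erase _ _ hi₀] at hrel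
    have hτ0 : τ (p i₀) ≠ 0 := by
      intro e
      have := hτ (p i₀)
      rw [e, map_zero, mul_zero, Units.mul_left_eq_zero] at this
      exact Finsupp.mem_support_iff.1 hi₀ ((map_eq_zero f).1 this)
    rw [← W.smul_mem_iff hτ0, eq_neg_of_add_eq_zero_left hrel]
    refine neg_mem (sum_mem fun i hi => W.smul_mem _ ?_)
    exact hj i (Finset.mem_of_mem_erase hi) (Finset.ne_of_mem_erase hi)
  have ha : a ∈ p.support := Finset.min'_mem _ _
  have hb : b ∈ p.support := Finset.max'_mem _ _
  have hale : ∀ i ∈ p.support, a ≤ i := fun i hi => Finset.min'_le _ _ hi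
  have hble : ∀ i ∈ p.support, i ≤ b := fun i hi => Finset.le_max' _ _ hi
  -- The window `[a, b)` slides over all of `ℤ`: moving up, the new vector comes from the term at
  -- `b`; moving down, from the term at `a`.
  have hwin : ∀ j i : ℤ, a ≤ i → i < b → v (i + j) ∈ W := by
    intro j
    induction j using Int.induction_on with
    | zero =>
      intro i hai hib
      rw [add_zero]
      exact Submodule.subset_span
        (Finset.mem_coe.2 (Finset.mem_image_of_mem _ (Finset.mem_Ico.2 ⟨hai, hib⟩)))
    | succ j ih =>
      intro i hai hib
      rcases eq_or_ne (i + 1) b with e | e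
      · have := hsolve b hb j fun i hi hne => ih i (hale i hi) (lt_of_le_of_ne (hble i hi) hne)
        rwa [← e, add_right_comm, add_assoc] at this
      · have := ih (i + 1) (by omega) (by omega)
        rwa [add_right_comm, add_assoc] at this
    | pred j ih =>
      intro i hai hib
      rcases eq_or_ne i a with e | e
      · rw [e]
        refine hsolve a ha _ fun l hl hne => ?_
        have h1 := hale l hl
        have h2 := hble l hl
        have := ih (l - 1) (by omega) (by omega)
        rwa [show l - 1 + -(j : ℤ) = l + (-j - 1) by ring] at this
      · have := ih (i - 1) (by omega) (by omega)
        rwa [show i - 1 + -(j : ℤ) = i + (-j - 1) by ring] at this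
  have hall : ∀ j, v j ∈ W := by
    intro j
    have := hsolve b hb (j - b) fun i hi hne =>
      hwin _ i (hale i hi) (lt_of_le_of_ne (hble i hi) hne)
    rwa [add_sub_cancel] at this
  refine ⟨W, ⟨_, rfl⟩, fun s => ?_⟩
  obtain ⟨q, rfl⟩ := h.exists_sum s
  rw [Finsupp.sum, Finset.op_sum, Finset.sum_smul]
  refine sum_mem fun i _ => ?_
  rw [MulOpposite.op_mul, mul_smul, ← hf]
  exact W.smul_mem _ (hall i)

lemma module_finite [Nontrivial R] [Module K M] (h : IsOuterSkewLaurent f u)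
    (hf : ∀ (k : K) (x : M), k • x = op (f k) • x) [Module.Finite Rᵐᵒᵖ M]
    (hM : IsRightTorsion R M) : Module.Finite K M := by
  choose r hr hx using hM
  choose W hW hWx using fun x => h.exists_fg_submodule hf (hr x) (hx x)
  obtain ⟨G, hG⟩ := (Module.Finite.fg_top : (⊤ : Submodule Rᵐᵒᵖ M).FG)
  refine ⟨?_⟩
  have htop : (⊤ : Submodule K M) = ⨆ x ∈ G, W x := by
    refine (eq_top_iff.2 fun y _ => ?_).symm
    have hy : y ∈ Submodule.span Rᵐᵒᵖ (G : Set M) := by rw [hG]; trivial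
    obtain ⟨c, -, rfl⟩ := Submodule.mem_span_finset.1 hy
    exact sum_mem fun x hxG => (le_biSup W hxG) (hWx x (c x).unop)
  rw [htop]
  exact Submodule.fg_biSup G W fun x _ => hW x

theorem isRightCyclic [Nontrivial R] (h : IsOuterSkewLaurent f u) [Module.Finite Rᵐᵒᵖ M]
    (hM : IsRightTorsion R M) : IsRightCyclic R M := by
  -- Through `g`, every `R`-submodule of `M` is a `K`-subspace, so finite dimension over `K` gives
  -- both chain conditions.
  let g : K →+* Rᵐᵒᵖ := f.toOpposite fun x y => (Commute.all x y).map f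
  let _ : Module K M := Module.compHom M g
  let _ : Module K Rᵐᵒᵖ := Module.compHom Rᵐᵒᵖ g
  have : IsScalarTower K Rᵐᵒᵖ M := ⟨fun k r x => mul_smul (g k) r x⟩
  have hfin : Module.Finite K M := h.module_finite (fun _ _ => rfl) hM
  have : IsArtinian Rᵐᵒᵖ M := isArtinian_of_tower K inferInstance
  have : IsNoetherian Rᵐᵒᵖ M := isNoetherian_of_tower K inferInstance
  have := h.isSimpleRing
  exact isRightCyclic_of_isSimpleRing hM

end IsOuterSkewLaurent

/-! ### The action of `t` on `S` and the commutator subgroup -/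

/-- Evaluation at the real root `(3 + √5) / 2 > 1` of `t² - 3t + 1` factors through `S m` because `m
> 0`, and no nonzero power of this root is `1`. -/
lemma tpow_ne_one {m : ℕ} (hm : 0 < m) {k : ℤ} (hk : k ≠ 0) : tpow m k ≠ 1 := by
  set l : ℝ := (3 + √5) / 2 with hl
  have h5 : √5 ^ 2 = (5 : ℝ) := Real.sq_sqrt (by norm_num)
  have h5' : 0 ≤ √(5 : ℝ) := Real.sqrt_nonneg _
  have hl1 : 1 < l := by rw [hl]; linarith
  have hroot : l ^ 2 - 3 * l + 1 = 0 := by rw [hl]; linear_combination h5 / 4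
  let u : ℝˣ := Units.mk0 l (by positivity)
  let e : ℚ[T;T⁻¹] →+* ℝ := LaurentPolynomial.eval₂ (algebraMap ℚ ℝ) u
  have he : ∀ k : ℤ, e (LaurentPolynomial.T k) = l ^ k := fun k => by
    simp [e, u, LaurentPolynomial.eval₂_T]
  have hker : ∀ a ∈ Ideal.span
      {((LaurentPolynomial.T 2 - 3 * LaurentPolynomial.T 1 + 1 : ℚ[T;T⁻¹]) ^ m)}, e a = 0 := by
    intro a ha
    obtain ⟨b, rfl⟩ := Ideal.mem_span_singleton.1 ha
    have h2 : l ^ (2 : ℤ) = l ^ 2 := by norm_cast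
    rw [map_mul, map_pow, map_add, map_sub, map_mul, he, he, map_ofNat, map_one, zpow_one, h2,
      hroot, zero_pow hm.ne', zero_mul]
  intro h
  have h1 := congrArg (Ideal.Quotient.lift _ e hker) h
  rw [tpow, Ideal.Quotient.lift_mk, map_one, he] at h1
  exact hk ((zpow_eq_one_iff_right₀ (by linarith) hl1.ne').1 h1)

/-- `(t - 1)(t - 2)` is `1` plus the nilpotent `t² - 3t + 1`. -/
lemma isUnit_tpow_one_sub_one (m : ℕ) : IsUnit (tpow m 1 - 1) := by
  have hT : (tpow m 2 - 3 * tpow m 1 + 1) ^ m = 0 := by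
    have := Ideal.Quotient.eq_zero_iff_mem.2 (Ideal.mem_span_singleton_self
      ((LaurentPolynomial.T 2 - 3 * LaurentPolynomial.T 1 + 1 : ℚ[T;T⁻¹]) ^ m))
    rwa [map_pow, map_add, map_sub, map_mul, map_ofNat, map_one] at this
  have h2 : tpow m 2 = tpow m 1 * tpow m 1 := by rw [← tpow_add]; norm_num
  have h : (tpow m 1 - 1) * (tpow m 1 - 2) = 1 + (tpow m 2 - 3 * tpow m 1 + 1) := by
    rw [h2]; ring
  refine isUnit_of_mul_isUnit_left (y := tpow m 1 - 2) ?_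
  rw [h]
  exact IsNilpotent.isUnit_one_add ⟨m, hT⟩

open scoped commutatorElement in
-- The commutator of `μ⁻¹` and `s` is `(t - 1) s`, and `t - 1` is invertible, so all of `S` consists
-- of commutators.
lemma mem_commutator_of_right_eq_one {m : ℕ} {g : Gamma m} (hg : g.right = 1) :
    g ∈ commutator (Gamma m) := by
  obtain ⟨v, hv⟩ := (isUnit_tpow_one_sub_one m).exists_right_inv
  set s : S m := v * g.left.toAdd with hs
  have h1 : tpow m 1 * s - s = g.left.toAdd := by
    rw [hs]; linear_combination g.left.toAdd * hv
  let x : Gamma m := SemidirectProduct.inl (Multiplicative.ofAdd s)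
  have h2 : g = ⁅(mu m)⁻¹, x⁆ := by
    rw [commutatorElement_def, inv_inv, mu_inv_mul_mul_mu, ← map_inv, ← map_mul, ← ofAdd_neg,
      ← ofAdd_add, ← sub_eq_add_neg, h1]
    ext
    · simp
    · simp [hg]
  rw [h2]
  exact Subgroup.commutator_mem_commutator (Subgroup.mem_top _) (Subgroup.mem_top _)

lemma single_mem_commRing {m : ℕ} {g : Gamma m} (hg : g.right = 1) (c : ℚ) :
    MonoidAlgebra.single g c ∈ commRing m :=
  ⟨MonoidAlgebra.single ⟨g, mem_commutator_of_right_eq_one hg⟩ c, by simp⟩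

/-! ### The coefficient field `K` inside `𝓡₁` -/

/-- The elements of `𝓡₁` that are fractions of elements of `ℚ[Γ₁, Γ₁]`. -/
def IsCommFraction (m : ℕ) (x : R1 m) : Prop :=
  ∃ a ∈ commRing m, ∃ s : denoms m, x * toR1 m s = toR1 m a

lemma IsCommFraction.commute_toR1 {m : ℕ} {x : R1 m} (hx : IsCommFraction m x) {c : ℚ[Gamma m]}
    (hc : c ∈ commRing m) : Commute (toR1 m c) x := by
  obtain ⟨a, ha, s, h⟩ := hx
  refine (isUnit_toR1 m s).mul_left_injective ?_
  have hcs : Commute (toR1 m c) (toR1 m s) :=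
    (show Commute c (s : ℚ[Gamma m]) from commRing_commute m hc s.2.1).map (toR1 m)
  have hca : Commute (toR1 m c) (toR1 m a) :=
    (show Commute c a from commRing_commute m hc ha).map (toR1 m)
  change toR1 m c * x * toR1 m s = x * toR1 m c * toR1 m s
  rw [mul_assoc, h, mul_assoc, hcs.eq, ← mul_assoc, h, hca.eq]

lemma IsCommFraction.commute {m : ℕ} {x y : R1 m} (hx : IsCommFraction m x)
    (hy : IsCommFraction m y) : Commute x y := by
  obtain ⟨a, ha, s, h⟩ := hy
  refine (isUnit_toR1 m s).mul_left_injective ?_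
  change x * y * toR1 m s = y * x * toR1 m s
  rw [mul_assoc, h, mul_assoc, ← (hx.commute_toR1 s.2.1).eq, ← mul_assoc, h,
    (hx.commute_toR1 ha).eq]

lemma isCommFraction_toR1 {m : ℕ} {c : ℚ[Gamma m]} (hc : c ∈ commRing m) :
    IsCommFraction m (toR1 m c) :=
  ⟨c, hc, 1, by simp⟩

/-- The subring of fractions of elements of `ℚ[Γ₁, Γ₁]`. -/
def commFractions (m : ℕ) : Subring (R1 m) where
  carrier := {x | IsCommFraction m x}
  zero_mem' := ⟨0, zero_mem _, 1, by simp⟩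
  one_mem' := ⟨1, one_mem _, 1, by simp⟩
  neg_mem' := by
    rintro x ⟨a, ha, s, h⟩
    exact ⟨-a, neg_mem ha, s, by rw [map_neg, ← h]; exact neg_mul x _⟩
  add_mem' := by
    rintro x y ⟨a, ha, s, h⟩ ⟨b, hb, t, h'⟩
    refine ⟨a * t + b * s, add_mem (mul_mem ha t.2.1) (mul_mem hb s.2.1), s * t, ?_⟩
    rw [add_mul, Submonoid.coe_mul, map_mul, map_add, map_mul, map_mul, ← mul_assoc, h,
      ← map_mul (toR1 m) (s : ℚ[Gamma m]), commRing_commute m s.2.1 t.2.1, map_mul, ← mul_assoc, h']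
  mul_mem' := by
    rintro x y ⟨a, ha, s, h⟩ ⟨b, hb, t, h'⟩
    refine ⟨a * b, mul_mem ha hb, t * s, ?_⟩
    rw [Submonoid.coe_mul, map_mul, mul_assoc, ← mul_assoc y, h',
      ((isCommFraction_toR1 hb).commute_toR1 s.2.1).symm.eq, ← mul_assoc, h, map_mul]

instance (m : ℕ) : Nontrivial (R1 m) := (toR1_injective m).nontrivial

instance (m : ℕ) : CommRing (commFractions m) where
  mul_comm x y := Subtype.ext (IsCommFraction.commute x.2 y.2).eq

instance (m : ℕ) : Field (commFractions m) :=
  Field.ofIsUnitOrEqZero fun x => by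
    obtain ⟨x, a, ha, s, h⟩ := x
    by_cases ha0 : a = 0
    · right
      rw [ha0, map_zero, (isUnit_toR1 m s).mul_left_eq_zero] at h
      exact Subtype.ext h
    · left
      obtain ⟨v, hv⟩ := isUnit_toR1 m ⟨a, ha, ha0⟩
      refine IsUnit.of_mul_eq_one (⟨toR1 m s * ↑v⁻¹, s, s.2.1, ⟨a, ha, ha0⟩, ?_⟩ : commFractions m)
        (Subtype.ext ?_)
      · rw [← hv, Units.inv_mul_cancel_right]
      · change x * (toR1 m s * ↑v⁻¹) = 1
        rw [← mul_assoc, h, Units.mul_inv_eq_one, hv]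

/-! ### `𝓡₁` as an outer skew Laurent ring -/

/-- An element of `Γ₁`, as a unit of `𝓡₁`. -/
def groupUnit (m : ℕ) : Gamma m →* (R1 m)ˣ :=
  (Units.map ((toR1 m : ℚ[Gamma m] →* R1 m).comp (MonoidAlgebra.of ℚ (Gamma m)))).comp
    (toUnits : Gamma m ≃* (Gamma m)ˣ).toMonoidHom

lemma groupUnit_val (m : ℕ) (g : Gamma m) :
    (groupUnit m g : R1 m) = toR1 m (MonoidAlgebra.single g 1) := rfl

lemma groupUnit_val_injective (m : ℕ) : Function.Injective fun g => (groupUnit m g : R1 m) :=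
  (toR1_injective m).comp (MonoidAlgebra.of_injective (R := ℚ))

lemma IsCommFraction.conj {m : ℕ} {x : R1 m} (hx : IsCommFraction m x) (g : Gamma m) :
    IsCommFraction m (groupUnit m g * x * ↑(groupUnit m g)⁻¹) := by
  obtain ⟨a, ha, s, h⟩ := hx
  refine ⟨_, conj_mem_commRing m g ha, ⟨_, conj_mem_denoms m g s.2⟩, ?_⟩
  rw [← map_inv, map_mul, map_mul, map_mul, map_mul, ← groupUnit_val, ← groupUnit_val, ← h]
  simp only [map_inv, mul_assoc, Units.inv_mul_cancel_left]

lemma mu_zpow (m : ℕ) (i : ℤ) : mu m ^ i = SemidirectProduct.inr (Multiplicative.ofAdd i) := by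
  rw [mu, ← map_zpow, ← ofAdd_zsmul, smul_eq_mul, mul_one]

/-- With the denominator `s` fixed, terms can be treated separately: `g = μ ^ i n` with `n ∈ S`, and
`n s⁻¹` lies in `K`. -/
lemma exists_sum_mul_inv (m : ℕ) (s : denoms m) (v : (R1 m)ˣ) (hv : (v : R1 m) = toR1 m s)
    (a : ℚ[Gamma m]) : ∃ p : ℤ →₀ commFractions m,
      toR1 m a * ↑v⁻¹ = p.sum fun i k => ↑(groupUnit m (mu m) ^ i) * (commFractions m).subtype k := by
  induction a using MonoidAlgebra.induction_linear with
  | zero => exact ⟨0, by simp⟩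
  | add a b ha hb =>
    obtain ⟨p, hp⟩ := ha
    obtain ⟨q, hq⟩ := hb
    refine ⟨p + q, ?_⟩
    rw [map_add, add_mul, hp, hq, Finsupp.sum_add_index']
    · simp
    · intro i k l
      rw [map_add, mul_add]
  | single g c =>
    set i : ℤ := g.right.toAdd
    have hg : ((mu m ^ i)⁻¹ * g).right = 1 := by
      rw [mu_zpow]
      simp [i]
    refine ⟨Finsupp.single i ⟨toR1 m (MonoidAlgebra.single ((mu m ^ i)⁻¹ * g) c) * ↑v⁻¹,
      _, single_mem_commRing hg c, s, ?_⟩, ?_⟩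
    · rw [← hv, Units.inv_mul_cancel_right]
    · rw [Finsupp.sum_single_index (by simp), ← map_zpow, groupUnit_val]
      change _ = (_ : R1 m) * ((_ : R1 m) * (_ : R1 m))
      rw [← mul_assoc, ← map_mul, MonoidAlgebra.single_mul_single, mul_inv_cancel_left, one_mul]

theorem isOuterSkewLaurent_R1 {m : ℕ} (hm : 0 < m) :
    IsOuterSkewLaurent (commFractions m).subtype (groupUnit m (mu m)) where
  exists_mul_zpow i k := by
    refine ⟨⟨_, IsCommFraction.conj k.2 (mu m ^ i)⁻¹⟩, ?_⟩
    change (k : R1 m) * _ = _ * (_ * _ * _)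
    rw [← map_zpow, map_inv, inv_inv, mul_assoc, Units.mul_inv_cancel_left]
  exists_sum r := by
    obtain ⟨a, s, h⟩ := exists_right_fraction m r
    obtain ⟨v, hv⟩ := isUnit_toR1 m s
    obtain ⟨p, hp⟩ := exists_sum_mul_inv m s v hv a
    exact ⟨p, by rw [← hp, ← h, ← hv, Units.mul_inv_cancel_right]⟩
  exists_not_commute i hi := by
    -- The witness is the group element `1 ∈ S`: commuting with `μ ^ i` would give `t ^ (-i) = 1`.
    let g : Gamma m := SemidirectProduct.inl (Multiplicative.ofAdd 1)
    refine ⟨⟨groupUnit m g, isCommFraction_toR1 (single_mem_commRing (by simp [g]) 1)⟩, ?_⟩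
    intro h
    change (groupUnit m g : R1 m) * _ = _ * (groupUnit m g : R1 m) at h
    rw [← map_zpow, ← Units.val_mul, ← Units.val_mul, ← map_mul, ← map_mul] at h
    have h1 : g * mu m ^ i = mu m ^ i * g := groupUnit_val_injective m h
    rw [mu_zpow] at h1
    have h1 := congrArg SemidirectProduct.left h1
    rw [SemidirectProduct.mul_left, SemidirectProduct.mul_left] at h1
    have h2 : tpow m (-i) = 1 := by
      change Multiplicative.ofAdd (1 : S m) * tMul m _ 1 =
        1 * Multiplicative.ofAdd (tpow m (-i) * 1) at h1
      rw [map_one (tMul m _), mul_one, one_mul, mul_one] at h1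
      exact (Multiplicative.ofAdd.injective h1).symm
    exact tpow_ne_one hm (neg_ne_zero.2 hi) h2

end HigherOrder

end

theorem corollary4p3 (m : ℕ) (hm : 0 < m) (M : Type*) [AddCommGroup M]
    [Module (HigherOrder.R1 m)ᵐᵒᵖ M] [Module.Finite (HigherOrder.R1 m)ᵐᵒᵖ M]
    (hM : HigherOrder.IsRightTorsion (HigherOrder.R1 m) M) :
    HigherOrder.IsRightCyclic (HigherOrder.R1 m) M :=
  (HigherOrder.isOuterSkewLaurent_R1 hm).isRightCyclic hM
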